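/- **Theorem (universal minimax lower bound).** Let $n\ge 2$ and let $\Theta\subset\mathbb{R}^n$ be bounded with $\inf_{\theta\in\Theta}\|\theta\|>0$ and with nonempty interior. Let $g:\mathbb{R}^n\to\mathbb{R}$ be three times differentiable and strongly convex, with gradient $\nabla g$ and Hessian $\Delta g$, and let the action set $\mathcal{A}:=\{x : g(x)\le 0\}$ be compact. For $\theta\neq 0$ let $a^\star(\theta)$ be a maximizer of $\theta^\top a$ over $a\in\mathcal{A}$, let $\mathcal{A}^\star\subseteq\mathcal{A}$ be the set of all maximizers of $\theta^\top a$ over $\mathcal A$, $\theta\in\Theta$, and let $\mathcal{A}^\star(m)$ be the union of the closed balls $\mathcal{B}_a(m)$ of radius $m$ centered at the points $a\in\mathcal{A}^\star$. Assume that there are $m'>0$, $0<\nabla_g^{\min}\le\nabla_g^{\max}$, $0<\lambda_{\min}^\Delta<\lambda_{\max}^\Delta$, $0<a_{\min}\le a_{\max}$ and $\alpha_{\mathcal A}\in(0,\pi/2)$ such that, for all $a\in\mathcal{A}^\star(m')$ and all $a'\in\mathcal{B}_a(m')$, * $\nabla_g^{\min}\le\|\nabla g(a)\|\le\nabla_g^{\max}$,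 and all eigenvalues of $\Delta g(a)$ lie in $[\lambda_{\min}^\Delta,\lambda_{\max}^\Delta]$; * $a_{\min}\le\|a\|\le a_{\max}$; * the angle between $a'$ and $\nabla g(a)$ is at most $\alpha_{\mathcal A}$. Assume moreover the following regularity of the Jacobian $\nabla a^\star(\theta)$: there is $\lambda_C>0$ such that the second-smallest eigenvalue (counted with multiplicity) of $\nabla a^\star(\theta)$ is at least $\lambda_C$ for all $\theta\in\Theta$; and the eigenvalues $\lambda_1(\theta),\dots,\lambda_n(\theta)$ and corresponding linearly independent eigenvectors $u_1(\theta),\dots,u_n(\theta)$ of $\nabla a^\star(\theta)$ can be selected as differentiable functions of $\theta$ on $\Theta$. In round $t=1,2,\dots$ a policy $\pi$ chooses, possibly at random, an action $a_t\in\mathcal{A}$ depending measurably on the past $a_1,Y_1,\dots,a_{t-1},Y_{t-1}$ and then observes $Y_t=\theta^{\star\top}a_t+\varepsilon_t$, where the $\varepsilon_t$ are i.i.d. with density $p$, and $\varepsilon_t$ is independent of the past and of $a_t$. Let $$\mathscr{R}_{\theta^\star}(T):=\sum_{t=1}^T\left(\theta^{\star\top}a^\star(\theta^\star)-\theta^{\star\top}a_t\right),$$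 and let $\mathbb{E}^\pi_{\theta^\star}$ denote the expectation under the parameter $\theta^\star$ and the policy $\pi$. Then there is a constant $c>0$, depending only on $n$, $g$ and $\Theta$, such that for every differentiable probability density $p$ on $\mathbb{R}$ for which $$\mathscr{I}_\varepsilon:=\mathbb{E}\left[\left(\frac{p'(\varepsilon)}{p(\varepsilon)}\right)^2\right]$$ is finite and positive there is a $T_0$ such that, for every policy $\pi$ and every $T\ge T_0$, $$\sup_{\theta^\star\in\Theta}\mathbb{E}^\pi_{\theta^\star}\left[\mathscr{R}_{\theta^\star}(T)\right]\ \ge\ c\,\sqrt{T/\mathscr{I}_\varepsilon}.$$ -/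

import Mathlib

open MeasureTheory ProbabilityTheory Set
open scoped RealInnerProductSpace

noncomputable section

namespace LinearBandit

/-- `ℝⁿ` with its Euclidean inner product. -/
abbrev E (n : ℕ) : Type := EuclideanSpace ℝ (Fin n)

/-! ### Actions, optimal actions -/

/-- The action set `{x | g x ≤ 0}`. -/
def actionSet {n : ℕ} (g : E n → ℝ) : Set (E n) := {x | g x ≤ 0}

/-- The set of maximizers over `A` of the linear reward `a ↦ θᵀ a`. -/
def maximizers {n : ℕ} (A : Set (E n)) (θ : E n) : Set (E n) :=
  {a | a ∈ A ∧ ∀ b ∈ A, ⟪θ, b⟫ ≤ ⟪θ, a⟫}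

open Classical in
/-- A reward-maximizing action `a⋆(θ)`. Under the assumptions below the maximizer exists and is
unique for every `θ ≠ 0`, so that no choice is involved there. -/
def aStar {n : ℕ} (A : Set (E n)) (θ : E n) : E n :=
  if h : (maximizers A θ).Nonempty then h.some else 0

/-- The set of all actions that are optimal for some parameter of `Θ`. -/
def optimalActions {n : ℕ} (A Θ : Set (E n)) : Set (E n) := ⋃ θ ∈ Θ, maximizers A θ

/-- The union of the balls of radius `m` around the points of `optimalActions A Θ`. -/
def optimalActionsNhd {n : ℕ} (A Θ : Set (E n)) (m : ℝ) : Set (E n) :=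
  ⋃ a ∈ optimalActions A Θ, Metric.closedBall a m

/-! ### Assumptions on the parameter set and on the action set -/

/-- `Θ` is bounded, bounded away from the origin, and has an interior point. -/
structure ParameterAssumption {n : ℕ} (Θ : Set (E n)) : Prop where
  bounded : Bornology.IsBounded Θ
  away_from_zero : ∃ θmin : ℝ, 0 < θmin ∧ ∀ θ ∈ Θ, θmin ≤ ‖θ‖
  interior_nonempty : (interior Θ).Nonempty

/-- The Hessian of `g` at `a`, as an endomorphism of `ℝⁿ`. -/
def hessian {n : ℕ} (g : E n → ℝ) (a : E n) : E n →L[ℝ] E n :=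
  fderiv ℝ (gradient g) a

/-- The action set `{g ≤ 0}` is compact, `g` is three times differentiable and strongly convex,
and, on a neighbourhood of the optimal actions, there are uniform bounds on the gradient and on
the eigenvalues of the Hessian of `g`, on the norms of the actions, and on the angle between
actions and normals. -/
structure ActionSetAssumption {n : ℕ} (g : E n → ℝ) (Θ : Set (E n)) : Prop where
  compact : IsCompact (actionSet g)
  contDiff_two : ContDiff ℝ 2 g
  three_times_differentiable : Differentiable ℝ (iteratedFDeriv ℝ 2 g)
  strongly_convex : ∃ m : ℝ, 0 < m ∧ StrongConvexOn univ m g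
  local_bounds :
    ∃ m' : ℝ, 0 < m' ∧
      -- gradient and Hessian
      (∃ gradMin gradMax lamMin lamMax : ℝ,
        0 < gradMin ∧ 0 < lamMin ∧ lamMin < lamMax ∧
        ∀ a ∈ optimalActionsNhd (actionSet g) Θ m',
          gradMin ≤ ‖gradient g a‖ ∧ ‖gradient g a‖ ≤ gradMax ∧
          ∀ μ : ℝ, Module.End.HasEigenvalue (hessian g a : E n →ₗ[ℝ] E n) μ →
            lamMin ≤ μ ∧ μ ≤ lamMax) ∧
      -- norms of actions
      (∃ aMin aMax : ℝ, 0 < aMin ∧ aMin ≤ aMax ∧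
        ∀ a ∈ optimalActionsNhd (actionSet g) Θ m', aMin ≤ ‖a‖ ∧ ‖a‖ ≤ aMax) ∧
      -- angles between actions and normals
      (∃ α : ℝ, 0 < α ∧ α < Real.pi / 2 ∧
        ∀ a ∈ optimalActionsNhd (actionSet g) Θ m', ∀ a' ∈ Metric.closedBall a m',
          InnerProductGeometry.angle a' (gradient g a) ≤ α)

/-! ### Regularity of the optimal action map -/

/-- The Jacobian `∇a⋆(θ)`. -/
def jacobianAStar {n : ℕ} (A : Set (E n)) (θ : E n) : E n →L[ℝ] E n :=
  fderiv ℝ (aStar A) θ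

/-- The second smallest of the real eigenvalues of `L`, counted with multiplicity, i.e. the entry
of index `1` of the nondecreasing list of the roots of the characteristic polynomial (with the
value `0` if there are fewer than two roots). -/
def secondSmallestEigenvalue {n : ℕ} (L : E n →L[ℝ] E n) : ℝ :=
  ((LinearMap.charpoly (L : E n →ₗ[ℝ] E n)).roots.sort (· ≤ ·)).getD 1 0

/-- Regularity conditions on the action set: the second smallest eigenvalue of `∇a⋆` is bounded
below on `Θ` by a positive constant, and eigenvalues and a full system of eigenvectors
of `∇a⋆` can be selected differentiably on `Θ`. -/
structure ActionRegularity {n : ℕ} (A Θ : Set (E n)) : Prop where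
  eigenvalue_lower_bound : ∃ lamC : ℝ, 0 < lamC ∧
    ∀ θ ∈ Θ, lamC ≤ secondSmallestEigenvalue (jacobianAStar A θ)
  differentiable_eigensystem :
    ∃ (lam : Fin n → E n → ℝ) (u : Fin n → E n → E n),
      (∀ i, DifferentiableOn ℝ (lam i) Θ) ∧ (∀ i, DifferentiableOn ℝ (u i) Θ) ∧
      ∀ θ ∈ Θ, LinearIndependent ℝ (fun i => u i θ) ∧
        ∀ i, jacobianAStar A θ (u i θ) = lam i θ • u i θ

/-! ### Noise -/

/-- The law on `ℝ` with density `p`. -/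
def noiseLaw (p : ℝ → ℝ) : Measure ℝ := volume.withDensity (fun x => ENNReal.ofReal (p x))

/-- `I_ε = 𝔼[(p'(ε) / p(ε))²]` for `ε` with density `p`. -/
def fisherInfo (p : ℝ → ℝ) : ℝ := ∫ x, (deriv p x / p x) ^ 2 ∂(noiseLaw p)

/-- `p` is a differentiable probability density on `ℝ` with finite and positive `I_ε`. -/
structure NoiseAssumption (p : ℝ → ℝ) : Prop where
  nonneg : ∀ x, 0 ≤ p x
  differentiable : Differentiable ℝ p
  total_mass : ∫⁻ x, ENNReal.ofReal (p x) = 1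
  fisher_finite : Integrable (fun x => (deriv p x / p x) ^ 2) (noiseLaw p)
  fisher_pos : 0 < fisherInfo p

/-! ### Policies and their interaction with the environment -/

/-- A history of `t` rounds: the list of the pairs (action, observed reward). -/
abbrev History (n t : ℕ) : Type := Fin t → E n × ℝ

/-- A causal, possibly randomized policy with actions in `A`: after `t` rounds the
next action is drawn from a law that depends measurably on the history of these rounds. -/
structure Policy {n : ℕ} (A : Set (E n)) where
  act : (t : ℕ) → Kernel (History n t) (E n)
  markov : ∀ t, IsMarkovKernel (act t)
  mem : ∀ t h, ∀ᵐ a ∂(act t h), a ∈ A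

/-- The law of the reward `θᵀ a + ε` of the action `a`, where `ε` has density `p`. -/
def rewardKernel {n : ℕ} (θ : E n) (p : ℝ → ℝ) : Kernel (E n) ℝ :=
  (Kernel.id ×ₖ Kernel.const (E n) (noiseLaw p)).map (fun q : E n × ℝ => ⟪θ, q.1⟫ + q.2)

/-- The law of the pair (action, reward) of the next round, given the history of `t` rounds. -/
def roundKernel {n : ℕ} {A : Set (E n)} (θ : E n) (p : ℝ → ℝ) (π : Policy A) (t : ℕ) :
    Kernel (History n t) (E n × ℝ) :=
  π.act t ⊗ₖ Kernel.prodMkLeft (History n t) (rewardKernel θ p)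

/-- The law of the history of the first `T` rounds when the parameter is `θ`, the noise is
independent over rounds with density `p`, and the actions are chosen by `π`. -/
def historyLaw {n : ℕ} {A : Set (E n)} (θ : E n) (p : ℝ → ℝ) (π : Policy A) :
    (T : ℕ) → Measure (History n T)
  | 0 => Measure.dirac (fun i => i.elim0)
  | T + 1 => (historyLaw θ p π T ⊗ₘ roundKernel θ p π T).map
      (fun q : History n T × (E n × ℝ) => (Fin.snoc q.1 q.2 : History n (T + 1)))

/-- The cumulative regret of a history of `T` rounds. -/
def regret {n : ℕ} (A : Set (E n)) (θ : E n) {T : ℕ} (h : History n T) : ℝ :=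
  ∑ t : Fin T, (⟪θ, aStar A θ⟫ - ⟪θ, (h t).1⟫)

/-- The expected cumulative regret over `T` rounds of the policy `π` at the parameter `θ`. -/
def expectedRegret {n : ℕ} {A : Set (E n)} (θ : E n) (p : ℝ → ℝ) (π : Policy A) (T : ℕ) : ℝ :=
  ∫ h, regret A θ h ∂(historyLaw θ p π T)

end LinearBandit

end

/-!
The bound follows from a comparison of two parameters. Fix `θ₀` in the interior of `Θ`, let
`a₀ = a⋆(θ₀)`, and let `θ₁ = θ₀ + δ v` with a unit vector `v` orthogonal to `a₀`; such a `v` exists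
since `n ≥ 2`. The reward of `a` distinguishes `θ₀` from `θ₁` only through
`δ ⟪v, a⟫ = δ ⟪v, a - a₀⟫`, so a policy learns which of the two is true only by playing actions away
from `a₀`, and this costs regret.

Quantitatively, strong convexity of `g` makes `{g ≤ 0}` a strongly convex set, whence the regret of
an action `a` is at least a multiple of `‖a - a⋆(θ)‖²` (`exists_quadratic_growth`). On the other
hand `‖a⋆(θ₁) - a⋆(θ₀)‖` is comparable to `δ` (`exists_displacing_direction`): `v` is not parallel
to `θ₀`, because the angle condition gives `⟪θ₀, a₀⟫ > 0`, so the direction of the parameter, which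
is the normal `∇g / ‖∇g‖` at the optimal action, turns at a rate proportional to `δ`, while `∇g` is
Lipschitz.

A density with finite Fisher information may have zeros, and its shifts need not be absolutely
continuous with respect to each other, so the two laws of the history are compared by their
Hellinger affinity rather than by their relative entropy. A shift of the noise by `h` costs at most
`I h² / 8` of affinity (`NoiseAssumption.one_le_affinity_add`), and by induction over the rounds the
affinity lost in `T` rounds is at most `I δ² / 16` times the sum of the expectations of `∑ₜ ⟪v,
aₜ⟫²` under the two parameters (`one_le_affinity_historyLaw_add`). If `S` bounds the expected
squared deviations from the optimal action under both parameters, this loss is of order `I (δ² S + T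
δ⁴)`; as long as it is small, `S` is at least of order `T δ²` (`deviation_lower_bound`). The choice
`δ² = ε / √(T I)`, with a small `ε` that depends only on the geometry, yields `S ≥ c √(T / I)` in
either case.
-/

open MeasureTheory ProbabilityTheory Set
open scoped RealInnerProductSpace

noncomputable section
namespace LinearBandit

/-! ### Hellinger affinity of shifted densities -/

namespace NoiseAssumption

variable {p : ℝ → ℝ}

lemma continuous (hp : NoiseAssumption p) : Continuous p := hp.differentiable.continuous

lemma deriv_eq_zero (hp : NoiseAssumption p) {x : ℝ} (hx : p x = 0) : deriv p x = 0 :=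
  IsLocalMin.deriv_eq_zero (Filter.Eventually.of_forall fun y => hx ▸ hp.nonneg y)

lemma measurable_score (hp : NoiseAssumption p) :
    Measurable fun x => (deriv p x / p x) ^ 2 * p x :=
  (((measurable_deriv p).div hp.continuous.measurable).pow_const 2).mul hp.continuous.measurable

lemma measurable_density (hp : NoiseAssumption p) : Measurable fun x => ENNReal.ofReal (p x) :=
  hp.continuous.measurable.ennreal_ofReal

lemma lintegral_score (hp : NoiseAssumption p) :
    ∫⁻ x, ENNReal.ofReal ((deriv p x / p x) ^ 2 * p x) = ENNReal.ofReal (fisherInfo p) := by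
  rw [fisherInfo, ofReal_integral_eq_lintegral_ofReal hp.fisher_finite
    (Filter.Eventually.of_forall fun x => sq_nonneg _), noiseLaw,
    lintegral_withDensity_eq_lintegral_mul _ hp.measurable_density]
  · refine lintegral_congr fun x => ?_
    rw [Pi.mul_apply, ENNReal.ofReal_mul (sq_nonneg _), mul_comm]
  · exact (((measurable_deriv p).div hp.continuous.measurable).pow_const 2).ennreal_ofReal

lemma integrable_score (hp : NoiseAssumption p) :
    Integrable fun x => (deriv p x / p x) ^ 2 * p x := by
  refine ⟨hp.measurable_score.aestronglyMeasurable, ?_⟩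
  rw [hasFiniteIntegral_iff_ofReal (Filter.Eventually.of_forall fun x =>
    mul_nonneg (sq_nonneg _) (hp.nonneg x)), hp.lintegral_score]
  exact ENNReal.ofReal_lt_top

/-- The derivative of `√(p + ε)` is dominated by the score. The regularization by `ε` is needed
because `√p` may fail to be differentiable at the zeros of `p`. -/
lemma sq_deriv_sqrt_add_le (hp : NoiseAssumption p) {ε : ℝ} (hε : 0 < ε) (x : ℝ) :
    (deriv p x / (2 * √(p x + ε))) ^ 2 ≤ (deriv p x / p x) ^ 2 * p x / 4 := by
  have hpx := hp.nonneg x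
  rcases hpx.eq_or_lt with h0 | h0
  · simp [hp.deriv_eq_zero h0.symm]
  · rw [div_pow, mul_pow, Real.sq_sqrt (by positivity)]
    have : (deriv p x / p x) ^ 2 * p x / 4 = (deriv p x) ^ 2 / (4 * p x) := by field_simp
    rw [this]
    refine div_le_div_of_nonneg_left (sq_nonneg _) (by positivity) (by linarith)

lemma sq_sqrt_add_sub_le (hp : NoiseAssumption p) {ε : ℝ} (hε : 0 < ε) {x y : ℝ} (hxy : x < y) :
    (√(p y + ε) - √(p x + ε)) ^ 2 ≤
      (y - x) * ∫ u in x..y, (deriv p u / p u) ^ 2 * p u / 4 := by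
  set q : ℝ → ℝ := fun u => (deriv p u / p u) ^ 2 * p u / 4 with hq
  set s : ℝ → ℝ := fun u => deriv p u / (2 * √(p u + ε)) with hs
  have hqi : IntervalIntegrable q volume x y := (hp.integrable_score.div_const 4).intervalIntegrable
  have hsm : Measurable s :=
    (measurable_deriv p).div
      (((hp.continuous.add continuous_const).sqrt.measurable).const_mul 2)
  have hsq : ∀ u, s u ^ 2 ≤ q u := fun u => hp.sq_deriv_sqrt_add_le hε u
  have hsi : IntervalIntegrable s volume x y := by
    refine IntervalIntegrable.mono_fun (hqi.add (intervalIntegrable_const (c := (1 : ℝ))))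
      hsm.aestronglyMeasurable (Filter.Eventually.of_forall fun u => ?_)
    have h1 := hsq u
    have h2 : 0 ≤ q u := (sq_nonneg _).trans h1
    change |s u| ≤ |q u + 1|
    rw [abs_of_nonneg (by linarith : 0 ≤ q u + 1)]
    nlinarith [sq_abs (s u), sq_nonneg (|s u| - 1)]
  have hderiv : ∀ u ∈ uIcc x y, HasDerivAt (fun u => √(p u + ε)) (s u) u := fun u _ =>
    ((hp.differentiable u).hasDerivAt.add_const ε).sqrt (by have := hp.nonneg u; positivity)
  have hftc := intervalIntegral.integral_eq_sub_of_hasDerivAt hderiv hsi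
  have hd : 0 < y - x := sub_pos.2 hxy
  -- Cauchy-Schwarz, by integrating the square of the deviation of `s` from its mean `m`.
  set m := (√(p y + ε) - √(p x + ε)) / (y - x) with hm
  have hnn : 0 ≤ ∫ u in x..y, (q u - 2 * m * s u + m ^ 2) :=
    intervalIntegral.integral_nonneg hxy.le fun u _ => by
      nlinarith [hsq u, sq_nonneg (s u - m)]
  rw [intervalIntegral.integral_add (hqi.sub (hsi.const_mul _)) intervalIntegrable_const,
    intervalIntegral.integral_sub hqi (hsi.const_mul _), intervalIntegral.integral_const_mul,
    hftc, intervalIntegral.integral_const, smul_eq_mul] at hnn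
  have hmul : √(p y + ε) - √(p x + ε) = m * (y - x) := by rw [hm]; field_simp
  rw [hmul] at hnn ⊢
  nlinarith

lemma sq_sqrt_sub_le (hp : NoiseAssumption p) {x y : ℝ} (hxy : x < y) :
    (√(p y) - √(p x)) ^ 2 ≤ (y - x) * ∫ u in x..y, (deriv p u / p u) ^ 2 * p u / 4 := by
  have hlim : Filter.Tendsto (fun ε : ℝ => (√(p y + ε) - √(p x + ε)) ^ 2)
      (nhdsWithin 0 (Ioi 0)) (nhds ((√(p y) - √(p x)) ^ 2)) := by
    have hc : Continuous fun ε : ℝ => (√(p y + ε) - √(p x + ε)) ^ 2 := by fun_prop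
    simpa using (hc.tendsto 0).mono_left nhdsWithin_le_nhds
  exact le_of_tendsto hlim (eventually_nhdsWithin_of_forall fun ε hε =>
    hp.sq_sqrt_add_sub_le hε hxy)

lemma lintegral_sq_sqrt_shift_sub_le (hp : NoiseAssumption p) {h : ℝ} (hh : 0 < h) :
    ∫⁻ x, ENNReal.ofReal ((√(p (x + h)) - √(p x)) ^ 2) ≤
      ENNReal.ofReal (fisherInfo p / 4 * h ^ 2) := by
  set q : ℝ → ℝ := fun u => (deriv p u / p u) ^ 2 * p u / 4 with hq
  have hq0 : ∀ u, 0 ≤ q u := fun u => by have := hp.nonneg u; positivity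
  have hqm : Measurable q := hp.measurable_score.div_const 4
  have hqi : Integrable q := hp.integrable_score.div_const 4
  have hq_int : ∫⁻ x, ENNReal.ofReal (q x) = ENNReal.ofReal (fisherInfo p / 4) := by
    have h4 : (0 : ℝ) < 4 := by norm_num
    simp only [hq, ENNReal.ofReal_div_of_pos h4]
    simp only [div_eq_mul_inv _ (ENNReal.ofReal 4)]
    rw [lintegral_mul_const _ hp.measurable_score.ennreal_ofReal, hp.lintegral_score]
  have hpt : ∀ x, ENNReal.ofReal ((√(p (x + h)) - √(p x)) ^ 2) ≤
      ENNReal.ofReal h * ∫⁻ u in Ioc 0 h, ENNReal.ofReal (q (x + u)) := by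
    intro x
    have h1 := hp.sq_sqrt_sub_le (lt_add_of_pos_right x hh)
    rw [add_sub_cancel_left] at h1
    have h2 : ∫ u in (0 : ℝ)..h, q (x + u) = ∫ u in x..x + h, q u := by
      simp
    rw [← ofReal_integral_eq_lintegral_ofReal ((hqi.comp_add_left x).integrableOn)
      (Filter.Eventually.of_forall fun u => hq0 _), ← ENNReal.ofReal_mul hh.le,
      ← intervalIntegral.integral_of_le hh.le, h2]
    exact ENNReal.ofReal_le_ofReal h1
  have hmeas : Measurable (Function.uncurry fun x u : ℝ => ENNReal.ofReal (q (x + u))) :=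
    (hqm.comp (measurable_fst.add measurable_snd)).ennreal_ofReal
  calc ∫⁻ x, ENNReal.ofReal ((√(p (x + h)) - √(p x)) ^ 2)
      ≤ ∫⁻ x, ENNReal.ofReal h * ∫⁻ u in Ioc 0 h, ENNReal.ofReal (q (x + u)) :=
        lintegral_mono hpt
    _ = ENNReal.ofReal h * ∫⁻ u in Ioc 0 h, ∫⁻ x, ENNReal.ofReal (q (x + u)) := by
        rw [lintegral_const_mul _ (Measurable.lintegral_prod_right hmeas),
          lintegral_lintegral_swap hmeas.aemeasurable]
    _ = ENNReal.ofReal (fisherInfo p / 4 * h ^ 2) := by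
        simp_rw [lintegral_add_right_eq_self (fun x => ENNReal.ofReal (q x)), hq_int]
        rw [setLIntegral_const, Real.volume_Ioc, sub_zero,
          ← ENNReal.ofReal_mul (by have := hp.fisher_pos; positivity),
          ← ENNReal.ofReal_mul hh.le]
        congr 1; ring

/-- The squared Hellinger distance between two shifts of `p` is at most quadratic in the
distance of the shifts, with a constant proportional to the Fisher information. -/
lemma lintegral_sq_sqrt_sub_le (hp : NoiseAssumption p) (a b : ℝ) :
    ∫⁻ y, ENNReal.ofReal ((√(p (y - a)) - √(p (y - b))) ^ 2) ≤
      ENNReal.ofReal (fisherInfo p / 4 * (a - b) ^ 2) := by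
  wlog hab : a ≤ b generalizing a b with H
  · have := H b a (le_of_not_ge hab)
    rw [← neg_sub a b, neg_sq] at this
    refine le_of_eq_of_le (lintegral_congr fun y => ?_) this
    congr 1; ring
  rcases hab.eq_or_lt with rfl | hab
  · simp
  have h1 := hp.lintegral_sq_sqrt_shift_sub_le (sub_pos.2 hab)
  rw [← lintegral_sub_right_eq_self _ b] at h1
  rw [← neg_sub b a, neg_sq]
  refine le_of_eq_of_le (lintegral_congr fun y => ?_) h1
  rw [sub_add_sub_cancel]

lemma lintegral_density_sub (hp : NoiseAssumption p) (a : ℝ) :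
    ∫⁻ y, ENNReal.ofReal (p (y - a)) = 1 := by
  rw [lintegral_sub_right_eq_self (fun y => ENNReal.ofReal (p y)), hp.total_mass]

/-- Two shifts of `p` have Hellinger affinity `1 - O((a - b)²)`. -/
lemma one_le_affinity_add (hp : NoiseAssumption p) (a b : ℝ) :
    1 ≤ (∫⁻ y, ENNReal.ofReal (√(p (y - a)) * √(p (y - b)))) +
      ENNReal.ofReal (fisherInfo p / 8 * (a - b) ^ 2) := by
  have hm : ∀ c : ℝ, Measurable fun y => p (y - c) := fun c =>
    (hp.continuous.comp (continuous_id.sub continuous_const)).measurable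
  have key : ∫⁻ y, (ENNReal.ofReal (p (y - a)) + ENNReal.ofReal (p (y - b))) =
      ∫⁻ y, (2 * ENNReal.ofReal (√(p (y - a)) * √(p (y - b))) +
        ENNReal.ofReal ((√(p (y - a)) - √(p (y - b))) ^ 2)) := by
    refine lintegral_congr fun y => ?_
    have ha := hp.nonneg (y - a)
    have hb := hp.nonneg (y - b)
    rw [← ENNReal.ofReal_add ha hb, show (2 : ENNReal) = ENNReal.ofReal 2 by simp,
      ← ENNReal.ofReal_mul (by norm_num), ← ENNReal.ofReal_add (by positivity) (by positivity)]
    congr 1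
    nlinarith [Real.sq_sqrt ha, Real.sq_sqrt hb]
  rw [lintegral_add_left (hm a).ennreal_ofReal, hp.lintegral_density_sub,
    hp.lintegral_density_sub, lintegral_add_left, lintegral_const_mul] at key
  · have h2 : (2 : ENNReal) * 1 ≤ 2 * ((∫⁻ y, ENNReal.ofReal (√(p (y - a)) * √(p (y - b)))) +
        ENNReal.ofReal (fisherInfo p / 8 * (a - b) ^ 2)) := by
      rw [mul_add, show (2 : ENNReal) * 1 = 1 + 1 by norm_num, key]
      gcongr
      refine (hp.lintegral_sq_sqrt_sub_le a b).trans_eq ?_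
      rw [show (2 : ENNReal) = ENNReal.ofReal 2 by simp, ← ENNReal.ofReal_mul (by norm_num)]
      congr 1; ring
    exact (ENNReal.mul_le_mul_iff_right (by norm_num) (by norm_num)).1 h2
  · exact ((hm a).sqrt.mul (hm b).sqrt).ennreal_ofReal
  · exact ((hm a).sqrt.mul (hm b).sqrt).ennreal_ofReal.const_mul 2

end NoiseAssumption

/-! ### Likelihoods of histories -/

section Likelihood

variable {n : ℕ} {A : Set (E n)} {p : ℝ → ℝ}

lemma measurable_snoc (T : ℕ) :
    Measurable fun q : History n T × (E n × ℝ) => (Fin.snoc q.1 q.2 : History n (T + 1)) := by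
  refine measurable_pi_lambda _ fun i => ?_
  induction i using Fin.lastCases with
  | last => simpa using measurable_snd
  | cast i => simpa using measurable_fst.eval

instance (π : Policy A) (t : ℕ) : IsMarkovKernel (π.act t) := π.markov t

lemma NoiseAssumption.isProbabilityMeasure (hp : NoiseAssumption p) :
    IsProbabilityMeasure (noiseLaw p) :=
  ⟨by rw [noiseLaw, withDensity_apply _ MeasurableSet.univ, Measure.restrict_univ, hp.total_mass]⟩

lemma isMarkovKernel_rewardKernel (hp : NoiseAssumption p) (θ : E n) :
    IsMarkovKernel (rewardKernel θ p) := by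
  have := hp.isProbabilityMeasure
  exact Kernel.IsMarkovKernel.map _ (by fun_prop)

lemma lintegral_rewardKernel (hp : NoiseAssumption p) (θ a : E n) {f : ℝ → ENNReal}
    (hf : Measurable f) :
    ∫⁻ y, f y ∂(rewardKernel θ p a) = ∫⁻ y, f y * ENNReal.ofReal (p (y - ⟪θ, a⟫)) := by
  have := hp.isProbabilityMeasure
  have hm : Measurable fun q : E n × ℝ => ⟪θ, q.1⟫ + q.2 := by fun_prop
  rw [rewardKernel, Kernel.lintegral_map _ hm _ hf, Kernel.lintegral_prod (g := fun q : E n × ℝ => f (⟪θ, q.1⟫ + q.2)) _ _ _ (hf.comp hm),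
    Kernel.id_apply, lintegral_dirac' _ (by fun_prop), Kernel.const_apply, noiseLaw,
    lintegral_withDensity_eq_lintegral_mul _ hp.measurable_density (by fun_prop),
    ← lintegral_sub_right_eq_self _ ⟪θ, a⟫]
  refine lintegral_congr fun y => ?_
  simp [mul_comm]

/-- The reference measure on histories: actions are drawn by the policy, and rewards carry Lebesgue
measure irrespective of the action. -/
def baseLaw (π : Policy A) : (T : ℕ) → Measure (History n T)
  | 0 => Measure.dirac (fun i => i.elim0)
  | T + 1 => (baseLaw π T ⊗ₘ (π.act T ⊗ₖ Kernel.const _ (volume : Measure ℝ))).map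
      (fun q : History n T × (E n × ℝ) => (Fin.snoc q.1 q.2 : History n (T + 1)))

instance (π : Policy A) (T : ℕ) : SFinite (baseLaw π T) := by
  cases T <;> rw [baseLaw] <;> infer_instance

lemma lintegral_baseLaw_succ (π : Policy A) (T : ℕ) {f : History n (T + 1) → ENNReal}
    (hf : Measurable f) :
    ∫⁻ h, f h ∂(baseLaw π (T + 1)) =
      ∫⁻ h, ∫⁻ a, (∫⁻ y, f (Fin.snoc (α := fun _ => E n × ℝ) h (a, y))) ∂(π.act T h)
        ∂(baseLaw π T) := by
  have hs := measurable_snoc (n := n) T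
  rw [baseLaw, lintegral_map hf hs, Measure.lintegral_compProd
      (f := fun q : History n T × (E n × ℝ) => f (Fin.snoc (α := fun _ => E n × ℝ) q.1 q.2))
      (hf.comp hs)]
  refine lintegral_congr fun h => ?_
  have hh : Measurable fun q : E n × ℝ => f (Fin.snoc (α := fun _ => E n × ℝ) h q) :=
    hf.comp (hs.comp measurable_prodMk_left)
  exact Kernel.lintegral_compProd _ _ _ hh

/-- The density of `historyLaw θ p π T` with respect to `baseLaw π T`. -/
def likelihood (θ : E n) (p : ℝ → ℝ) {T : ℕ} (h : History n T) : ℝ :=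
  ∏ t, p ((h t).2 - ⟪θ, (h t).1⟫)

lemma likelihood_snoc (θ : E n) (p : ℝ → ℝ) {T : ℕ} (h : History n T) (q : E n × ℝ) :
    likelihood θ p (Fin.snoc (α := fun _ => E n × ℝ) h q) =
      likelihood θ p h * p (q.2 - ⟪θ, q.1⟫) := by
  simp [likelihood, Fin.prod_univ_castSucc]

lemma likelihood_nonneg (hp : NoiseAssumption p) (θ : E n) {T : ℕ} (h : History n T) :
    0 ≤ likelihood θ p h :=
  Finset.prod_nonneg fun _ _ => hp.nonneg _

lemma measurable_likelihood (hp : NoiseAssumption p) (θ : E n) (T : ℕ) :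
    Measurable fun h : History n T => likelihood θ p h := by
  have := hp.continuous.measurable
  unfold likelihood
  fun_prop

lemma isMarkovKernel_roundKernel (hp : NoiseAssumption p) (θ : E n) (π : Policy A) (T : ℕ) :
    IsMarkovKernel (roundKernel θ p π T) := by
  have := isMarkovKernel_rewardKernel hp θ
  rw [roundKernel]
  infer_instance

lemma isProbabilityMeasure_historyLaw (hp : NoiseAssumption p) (θ : E n) (π : Policy A) (T : ℕ) :
    IsProbabilityMeasure (historyLaw θ p π T) := by
  induction T with
  | zero => rw [historyLaw]; infer_instance
  | succ T ih =>
    have := isMarkovKernel_roundKernel hp θ π T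
    exact Measure.isProbabilityMeasure_map (measurable_snoc T).aemeasurable

lemma lintegral_historyLaw_succ (hp : NoiseAssumption p) (θ : E n) (π : Policy A) (T : ℕ)
    {f : History n (T + 1) → ENNReal} (hf : Measurable f) :
    ∫⁻ h, f h ∂(historyLaw θ p π (T + 1)) =
      ∫⁻ h, ∫⁻ a, (∫⁻ y, f (Fin.snoc (α := fun _ => E n × ℝ) h (a, y)) *
        ENNReal.ofReal (p (y - ⟪θ, a⟫))) ∂(π.act T h) ∂(historyLaw θ p π T) := by
  have hs := measurable_snoc (n := n) T
  have := isMarkovKernel_rewardKernel hp θ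
  have := isMarkovKernel_roundKernel hp θ π T
  have := isProbabilityMeasure_historyLaw hp θ π T
  rw [historyLaw, lintegral_map hf hs, Measure.lintegral_compProd
      (f := fun q : History n T × (E n × ℝ) => f (Fin.snoc (α := fun _ => E n × ℝ) q.1 q.2))
      (hf.comp hs)]
  refine lintegral_congr fun h => ?_
  have hh : Measurable fun q : E n × ℝ => f (Fin.snoc (α := fun _ => E n × ℝ) h q) :=
    hf.comp (hs.comp measurable_prodMk_left)
  rw [roundKernel, Kernel.lintegral_compProd _ _ _ hh]
  refine lintegral_congr fun a => ?_
  exact lintegral_rewardKernel hp θ a (hh.comp measurable_prodMk_left)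

lemma measurable_lintegral_snoc (π : Policy A) (T : ℕ)
    {f : History n T × E n → ℝ → ENNReal} (hf : Measurable (Function.uncurry f)) :
    Measurable fun h => ∫⁻ a, (∫⁻ y, f (h, a) y) ∂(π.act T h) :=
  Measurable.lintegral_kernel_prod_right' (f := fun q => ∫⁻ y, f q y) hf.lintegral_prod_right

/-- `historyLaw θ p π T` has density `likelihood θ p` with respect to `baseLaw π T`. -/
lemma lintegral_historyLaw (hp : NoiseAssumption p) (θ : E n) (π : Policy A) (T : ℕ)
    {f : History n T → ENNReal} (hf : Measurable f) :
    ∫⁻ h, f h ∂(historyLaw θ p π T) =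
      ∫⁻ h, f h * ENNReal.ofReal (likelihood θ p h) ∂(baseLaw π T) := by
  induction T with
  | zero =>
    simp only [historyLaw, baseLaw, likelihood, Finset.univ_eq_empty, Finset.prod_empty,
      ENNReal.ofReal_one, mul_one]
  | succ T ih =>
    have hpm := hp.continuous.measurable
    have hs : Measurable fun q : (History n T × E n) × ℝ =>
        f (Fin.snoc (α := fun _ => E n × ℝ) q.1.1 (q.1.2, q.2)) :=
      hf.comp ((measurable_snoc T).comp ((measurable_fst.comp measurable_fst).prodMk
        ((measurable_snd.comp measurable_fst).prodMk measurable_snd)))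
    have hg : Measurable fun q : (History n T × E n) × ℝ =>
        f (Fin.snoc (α := fun _ => E n × ℝ) q.1.1 (q.1.2, q.2)) *
          ENNReal.ofReal (p (q.2 - ⟪θ, q.1.2⟫)) := hs.mul (by fun_prop)
    rw [lintegral_historyLaw_succ hp θ π T hf, lintegral_baseLaw_succ π T
      (hf.fun_mul (measurable_likelihood hp θ _).ennreal_ofReal),
      ih (measurable_lintegral_snoc π T
        (f := fun q y => f (Fin.snoc (α := fun _ => E n × ℝ) q.1 (q.2, y)) *
          ENNReal.ofReal (p (y - ⟪θ, q.2⟫))) hg)]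
    refine lintegral_congr fun h => ?_
    have hgh : Measurable fun q : E n × ℝ =>
        f (Fin.snoc (α := fun _ => E n × ℝ) h q) * ENNReal.ofReal (p (q.2 - ⟪θ, q.1⟫)) :=
      hg.comp (g := fun q : (History n T × E n) × ℝ =>
        f (Fin.snoc (α := fun _ => E n × ℝ) q.1.1 (q.1.2, q.2)) *
          ENNReal.ofReal (p (q.2 - ⟪θ, q.1.2⟫)))
        (f := fun q : E n × ℝ => ((h, q.1), q.2)) (by fun_prop)
    rw [← lintegral_mul_const _ hgh.lintegral_prod_right']
    refine lintegral_congr fun a => ?_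
    have hga : Measurable fun y : ℝ =>
        f (Fin.snoc (α := fun _ => E n × ℝ) h (a, y)) * ENNReal.ofReal (p (y - ⟪θ, a⟫)) :=
      hgh.comp measurable_prodMk_left
    rw [← lintegral_mul_const _ hga]
    refine lintegral_congr fun y => ?_
    rw [likelihood_snoc, ENNReal.ofReal_mul (likelihood_nonneg hp θ h)]
    ring

lemma lintegral_historyLaw_sum_succ (hp : NoiseAssumption p) (θ : E n) (π : Policy A) (T : ℕ)
    {k : E n → ENNReal} (hk : Measurable k) :
    ∫⁻ h, ∑ t, k (h t).1 ∂(historyLaw θ p π (T + 1)) =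
      (∫⁻ h, ∑ t, k (h t).1 ∂(historyLaw θ p π T)) +
        ∫⁻ h, ∫⁻ a, k a ∂(π.act T h) ∂(historyLaw θ p π T) := by
  have hpm := hp.continuous.measurable
  have hsum : ∀ T : ℕ, Measurable fun h : History n T => ∑ t, k (h t).1 := fun T => by fun_prop
  rw [lintegral_historyLaw_succ hp θ π T (hsum _), ← lintegral_add_left (hsum _)]
  refine lintegral_congr fun h => ?_
  simp_rw [Fin.sum_univ_castSucc, Fin.snoc_castSucc, Fin.snoc_last]
  have h1 : ∀ a, ∫⁻ y, (∑ t, k (h t).1 + k a) * ENNReal.ofReal (p (y - ⟪θ, a⟫)) =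
      ∑ t, k (h t).1 + k a := fun a => by
    rw [lintegral_const_mul, hp.lintegral_density_sub, mul_one]
    fun_prop
  simp_rw [h1]
  rw [lintegral_add_left measurable_const, lintegral_const, measure_univ, mul_one]

lemma two_mul_ofReal (x : ℝ) : 2 * ENNReal.ofReal x = ENNReal.ofReal (2 * x) := by
  rw [ENNReal.ofReal_mul (by norm_num), ENNReal.ofReal_ofNat]

lemma lintegral_likelihood (hp : NoiseAssumption p) (θ : E n) (π : Policy A) (T : ℕ) :
    ∫⁻ h, ENNReal.ofReal (likelihood θ p h) ∂(baseLaw π T) = 1 := by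
  have := isProbabilityMeasure_historyLaw hp θ π T
  simpa using (lintegral_historyLaw hp θ π T (measurable_const (a := (1 : ENNReal)))).symm

/-- The Hellinger affinity of the history laws at two parameters loses, in each round, at most the
Fisher information carried by the action about the difference of the parameters, averaged over the
two laws. -/
lemma one_le_affinity_historyLaw_add (hp : NoiseAssumption p) (θ₀ θ₁ : E n) (π : Policy A)
    (T : ℕ) {k : E n → ENNReal}
    (hk : k = fun a => ENNReal.ofReal (fisherInfo p / 16 * ⟪θ₁ - θ₀, a⟫ ^ 2)) :
    1 ≤ (∫⁻ h, ENNReal.ofReal (√(likelihood θ₀ p h) * √(likelihood θ₁ p h)) ∂(baseLaw π T)) +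
      ((∫⁻ h, ∑ t, k (h t).1 ∂(historyLaw θ₀ p π T)) +
        ∫⁻ h, ∑ t, k (h t).1 ∂(historyLaw θ₁ p π T)) := by
  have hkm : Measurable k := by rw [hk]; fun_prop
  have hpm := hp.continuous.measurable
  induction T with
  | zero => simp [baseLaw, likelihood]
  | succ T ih =>
    refine ih.trans ?_
    rw [lintegral_historyLaw_sum_succ hp θ₀ π T hkm, lintegral_historyLaw_sum_succ hp θ₁ π T hkm,
      show ∀ a b c d e : ENNReal, a + (b + c + (d + e)) = a + (c + e) + (b + d) from
        fun a b c d e => by ring]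
    gcongr ?_ + _
    have hsm : ∀ T, Measurable fun h : History n T =>
        ENNReal.ofReal (√(likelihood θ₀ p h) * √(likelihood θ₁ p h)) := fun T =>
      ((measurable_likelihood hp θ₀ T).sqrt.mul (measurable_likelihood hp θ₁ T).sqrt).ennreal_ofReal
    have hDm : Measurable fun h => ∫⁻ a, k a ∂(π.act T h) := hkm.lintegral_kernel
    set ρ : E n → ENNReal := fun a =>
      ∫⁻ y, ENNReal.ofReal (√(p (y - ⟪θ₀, a⟫)) * √(p (y - ⟪θ₁, a⟫))) with hρ
    have hρm : Measurable ρ := by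
      refine Measurable.lintegral_prod_right' (f := fun q : E n × ℝ =>
        ENNReal.ofReal (√(p (q.2 - ⟪θ₀, q.1⟫)) * √(p (q.2 - ⟪θ₁, q.1⟫)))) ?_
      fun_prop
    have hsucc : ∫⁻ h, ENNReal.ofReal (√(likelihood θ₀ p h) * √(likelihood θ₁ p h)) ∂(baseLaw π (T + 1)) =
        ∫⁻ h, ENNReal.ofReal (√(likelihood θ₀ p h) * √(likelihood θ₁ p h)) *
          ∫⁻ a, ρ a ∂(π.act T h) ∂(baseLaw π T) := by
      rw [lintegral_baseLaw_succ π T (hsm _)]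
      refine lintegral_congr fun h => ?_
      rw [← lintegral_const_mul _ hρm]
      refine lintegral_congr fun a => ?_
      rw [hρ, ← lintegral_const_mul _ (by fun_prop)]
      refine lintegral_congr fun y => ?_
      have h0 := likelihood_nonneg hp θ₀ h
      have h1 := likelihood_nonneg hp θ₁ h
      rw [likelihood_snoc, likelihood_snoc, Real.sqrt_mul h0, Real.sqrt_mul h1,
        ← ENNReal.ofReal_mul (by positivity)]
      congr 1; ring
    have hround : ∀ a, 1 ≤ ρ a + 2 * k a := fun a => by
      refine (hp.one_le_affinity_add ⟪θ₀, a⟫ ⟪θ₁, a⟫).trans_eq ?_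
      rw [hk]
      simp only [hρ]
      rw [two_mul_ofReal, inner_sub_left]
      congr 2; ring
    have hmean : ∀ h : History n T,
        2 * ENNReal.ofReal (√(likelihood θ₀ p h) * √(likelihood θ₁ p h)) ≤
        ENNReal.ofReal (likelihood θ₀ p h) + ENNReal.ofReal (likelihood θ₁ p h) := fun h => by
      have h0 := likelihood_nonneg hp θ₀ h
      have h1 := likelihood_nonneg hp θ₁ h
      rw [two_mul_ofReal, ← ENNReal.ofReal_add h0 h1]
      refine ENNReal.ofReal_le_ofReal ?_
      nlinarith [Real.sq_sqrt h0, Real.sq_sqrt h1,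
        sq_nonneg (√(likelihood θ₀ p h) - √(likelihood θ₁ p h))]
    rw [hsucc, lintegral_historyLaw hp θ₀ π T hDm, lintegral_historyLaw hp θ₁ π T hDm,
      ← lintegral_add_left (hDm.fun_mul (measurable_likelihood hp θ₀ T).ennreal_ofReal),
      ← lintegral_add_left ((hsm T).fun_mul hρm.lintegral_kernel)]
    refine lintegral_mono fun h => ?_
    set s := ENNReal.ofReal (√(likelihood θ₀ p h) * √(likelihood θ₁ p h)) with hs
    calc s = s * ∫⁻ _, 1 ∂(π.act T h) := by simp
      _ ≤ s * ∫⁻ a, (ρ a + 2 * k a) ∂(π.act T h) := by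
          gcongr with a; exact hround a
      _ = s * (∫⁻ a, ρ a ∂(π.act T h)) + (∫⁻ a, k a ∂(π.act T h)) * (2 * s) := by
          rw [lintegral_add_left hρm, lintegral_const_mul _ hkm]; ring
      _ ≤ _ := by
          rw [← mul_add]
          gcongr
          exact hmean h

/-- Two-point bound: if two nonnegative losses cannot both be small on any history, and the
information that separates the two history laws is small, then one of the two expected losses is
large. -/
lemma le_lintegral_add_lintegral (hp : NoiseAssumption p) (θ₀ θ₁ : E n) (π : Policy A) (T : ℕ)
    {k : E n → ENNReal}
    (hk : k = fun a => ENNReal.ofReal (fisherInfo p / 16 * ⟪θ₁ - θ₀, a⟫ ^ 2))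
    (hinfo : (∫⁻ h, ∑ t, k (h t).1 ∂(historyLaw θ₀ p π T)) +
        (∫⁻ h, ∑ t, k (h t).1 ∂(historyLaw θ₁ p π T)) ≤ ENNReal.ofReal (1 / 4))
    {X Y : History n T → ENNReal} (hX : Measurable X) (hY : Measurable Y) {m : ENNReal}
    (hm : ∀ h, m ≤ X h + Y h) :
    m * ENNReal.ofReal (1 / 4) ≤
      (∫⁻ h, X h ∂(historyLaw θ₀ p π T)) + ∫⁻ h, Y h ∂(historyLaw θ₁ p π T) := by
  have hl₀ := measurable_likelihood hp θ₀ T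
  have hl₁ := measurable_likelihood hp θ₁ T
  set M : ENNReal := ∫⁻ h, ENNReal.ofReal (min (likelihood θ₀ p h) (likelihood θ₁ p h))
    ∂(baseLaw π T) with hM
  have haff : ∫⁻ h, ENNReal.ofReal (√(likelihood θ₀ p h) * √(likelihood θ₁ p h)) ∂(baseLaw π T) ≤
      M + ENNReal.ofReal (1 / 2) := by
    calc _ ≤ ∫⁻ h, (ENNReal.ofReal (min (likelihood θ₀ p h) (likelihood θ₁ p h)) +
          ENNReal.ofReal (1 / 4) * (ENNReal.ofReal (likelihood θ₀ p h) +
            ENNReal.ofReal (likelihood θ₁ p h))) ∂(baseLaw π T) := by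
          refine lintegral_mono fun h => ?_
          have h0 := likelihood_nonneg hp θ₀ h
          have h1 := likelihood_nonneg hp θ₁ h
          rw [← ENNReal.ofReal_add h0 h1, ← ENNReal.ofReal_mul (by norm_num),
            ← ENNReal.ofReal_add (le_min h0 h1) (by positivity)]
          refine ENNReal.ofReal_le_ofReal ?_
          have e0 := Real.sq_sqrt h0
          have e1 := Real.sq_sqrt h1
          rcases min_cases (likelihood θ₀ p h) (likelihood θ₁ p h) with ⟨h2, _⟩ | ⟨h2, _⟩ <;>
            rw [h2]
          · nlinarith [sq_nonneg (2 * √(likelihood θ₀ p h) - √(likelihood θ₁ p h))]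
          · nlinarith [sq_nonneg (2 * √(likelihood θ₁ p h) - √(likelihood θ₀ p h))]
      _ = M + ENNReal.ofReal (1 / 2) := by
          rw [lintegral_add_left (hl₀.min hl₁).ennreal_ofReal,
            lintegral_const_mul _ (hl₀.ennreal_ofReal.fun_add hl₁.ennreal_ofReal),
            lintegral_add_left hl₀.ennreal_ofReal, lintegral_likelihood hp,
            lintegral_likelihood hp, one_add_one_eq_two, mul_comm,
            two_mul_ofReal]
          congr 2; norm_num
  have hM4 : ENNReal.ofReal (1 / 4) ≤ M := by
    have h1 := (one_le_affinity_historyLaw_add hp θ₀ θ₁ π T hk).trans (add_le_add haff hinfo)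
    rw [add_assoc, ← ENNReal.ofReal_add (by norm_num) (by norm_num)] at h1
    have h2 : ENNReal.ofReal (1 / 4) + ENNReal.ofReal (1 / 2 + 1 / 4) = 1 := by
      rw [← ENNReal.ofReal_add (by norm_num) (by norm_num)]; norm_num
    rw [← h2] at h1
    exact (ENNReal.add_le_add_iff_right ENNReal.ofReal_ne_top).1 h1
  rw [lintegral_historyLaw hp θ₀ π T hX, lintegral_historyLaw hp θ₁ π T hY,
    ← lintegral_add_left (hX.fun_mul hl₀.ennreal_ofReal)]
  calc m * ENNReal.ofReal (1 / 4) ≤ m * M := by gcongr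
    _ = ∫⁻ h, m * ENNReal.ofReal (min (likelihood θ₀ p h) (likelihood θ₁ p h)) ∂(baseLaw π T) :=
        (lintegral_const_mul _ (hl₀.min hl₁).ennreal_ofReal).symm
    _ ≤ _ := by
        refine lintegral_mono fun h => ?_
        calc _ ≤ (X h + Y h) * ENNReal.ofReal (min (likelihood θ₀ p h) (likelihood θ₁ p h)) := by
              gcongr; exact hm h
          _ ≤ _ := by
              rw [add_mul]
              gcongr
              · exact min_le_left _ _
              · exact min_le_right _ _

end Likelihood

/-! ### Geometry of the action set -/

section Geometry

variable {n : ℕ} {g : E n → ℝ} {A : Set (E n)}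

lemma aStar_mem_maximizers (hc : IsCompact A) (hne : A.Nonempty) (θ : E n) :
    aStar A θ ∈ maximizers A θ := by
  have h : (maximizers A θ).Nonempty := by
    obtain ⟨a, ha, hmax⟩ := hc.exists_isMaxOn hne
      (f := fun a => ⟪θ, a⟫) (by fun_prop)
    exact ⟨a, ha, fun b hb => hmax hb⟩
  rw [aStar, dif_pos h]
  exact h.some_mem

/-- The set `{g ≤ 0}` is strongly convex: around the midpoint of two of its points it contains a
ball whose radius is quadratic in their distance. Moving from the midpoint in the direction `θ`
shows that a linear reward decreases quadratically away from its maximizer. -/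
lemma exists_quadratic_growth (hc : IsCompact (actionSet g)) (hg : ContDiff ℝ 2 g)
    (hsc : ∃ m : ℝ, 0 < m ∧ StrongConvexOn univ m g) :
    ∃ κ : ℝ, 0 < κ ∧ ∀ θ a b : E n, a ∈ maximizers (actionSet g) θ → b ∈ actionSet g →
      κ * ‖θ‖ * ‖b - a‖ ^ 2 ≤ ⟪θ, a⟫ - ⟪θ, b⟫ := by
  obtain ⟨m, hm, hsc⟩ := hsc
  obtain ⟨R, hR⟩ := hc.isBounded.subset_closedBall 0
  have hcv := convex_closedBall (0 : E n) (R + 1)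
  obtain ⟨K, hK⟩ := hg.contDiffOn.exists_lipschitzOnWith (s := Metric.closedBall (0 : E n) (R + 1))
    (by norm_num) hcv (isCompact_closedBall _ _)
  have hnorm : ∀ x ∈ actionSet g, ‖x‖ ≤ R := fun x hx => by simpa using hR hx
  -- `K * r ≤ m / 8` keeps the ball inside the set; `4 R² r ≤ 1` keeps it where `g` is
  -- `K`-Lipschitz.
  set r : ℝ := min (m / (8 * (K + 1))) (1 / (4 * R ^ 2 + 1)) with hr
  have hr0 : 0 < r := lt_min (by positivity) (by positivity)
  have hr1 : K * r ≤ m / 8 := by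
    have h1 : r ≤ m / (8 * (K + 1)) := min_le_left _ _
    have h2 : (0 : ℝ) ≤ K := K.2
    rw [le_div_iff₀ (by positivity)] at h1
    nlinarith
  have hr2 : 4 * R ^ 2 * r ≤ 1 := by
    have h1 : r ≤ 1 / (4 * R ^ 2 + 1) := min_le_right _ _
    rw [le_div_iff₀ (by positivity)] at h1
    nlinarith
  refine ⟨2 * r, by positivity, fun θ a b ha hb => ?_⟩
  rcases eq_or_ne θ 0 with rfl | hθ
  · simp
  have hθ' : 0 < ‖θ‖ := norm_pos_iff.2 hθ
  have hA := hnorm a ha.1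
  have hB := hnorm b hb
  set d := ‖b - a‖ with hd
  have hd2 : d ^ 2 ≤ 4 * R ^ 2 := by
    have : d ≤ 2 * R := (norm_sub_le _ _).trans (by linarith)
    nlinarith [norm_nonneg (b - a)]
  set mid : E n := (1 / 2 : ℝ) • b + (1 / 2 : ℝ) • a with hmid
  set z : E n := (r * d ^ 2 / ‖θ‖) • θ with hz
  have hzn : ‖z‖ = r * d ^ 2 := by
    rw [hz, norm_smul, Real.norm_of_nonneg (by positivity)]; field_simp
  have hmidn : ‖mid‖ ≤ R := by
    refine (norm_add_le _ _).trans ?_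
    rw [norm_smul, norm_smul]; norm_num; linarith
  have hgm : g mid ≤ -(m / 8 * d ^ 2) := by
    have h := (show UniformConvexOn univ _ g from hsc).2 (mem_univ b) (mem_univ a)
      (show (0 : ℝ) ≤ 1 / 2 by norm_num) (show (0 : ℝ) ≤ 1 / 2 by norm_num) (by norm_num)
    have h1 : g a ≤ 0 := ha.1
    have h2 : g b ≤ 0 := hb
    simp only [smul_eq_mul] at h
    rw [← hmid, ← hd] at h
    nlinarith
  have hw : mid + z ∈ actionSet g := by
    have hdist := hK.dist_le_mul (mid + z) (by
        rw [mem_closedBall_zero_iff]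
        refine (norm_add_le _ _).trans ?_
        rw [hzn]; nlinarith) mid (by rw [mem_closedBall_zero_iff]; linarith)
    rw [Real.dist_eq, dist_eq_norm, add_sub_cancel_left, hzn] at hdist
    have h1 := (le_abs_self _).trans hdist
    have h2 : (K : ℝ) * (r * d ^ 2) ≤ m / 8 * d ^ 2 := by
      rw [← mul_assoc]; gcongr
    change g (mid + z) ≤ 0
    linarith
  have hfin := ha.2 _ hw
  rw [hmid, hz, inner_add_right, inner_add_right, inner_smul_right, inner_smul_right,
    inner_smul_right, real_inner_self_eq_norm_sq] at hfin
  have : r * d ^ 2 / ‖θ‖ * ‖θ‖ ^ 2 = r * d ^ 2 * ‖θ‖ := by field_simp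
  rw [this] at hfin
  linarith

/-- At a maximizer of a linear reward over `{g ≤ 0}`, the parameter is a nonnegative multiple of
the gradient of `g`. -/
lemma norm_smul_eq_norm_smul_gradient (hg : Differentiable ℝ g) {θ a : E n}
    (ha : a ∈ maximizers (actionSet g) θ) (hG : gradient g a ≠ 0) :
    ‖gradient g a‖ • θ = ‖θ‖ • gradient g a := by
  set G := gradient g a with hGdef
  by_contra hne
  have hlt : ⟪θ, G⟫ < ‖θ‖ * ‖G‖ :=
    lt_of_le_of_ne (real_inner_le_norm _ _) fun h => hne (inner_eq_norm_mul_iff_real.1 h)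
  have hG0 : 0 < ‖G‖ := norm_pos_iff.2 hG
  have hθ0 : 0 < ‖θ‖ := by
    rcases eq_or_ne θ 0 with rfl | h
    · simp at hlt
    · exact norm_pos_iff.2 h
  -- the direction `d` points into the set and strictly increases the reward
  set d : E n := ‖G‖ • θ - ‖θ‖ • G with hd
  have h1 : ⟪G, d⟫ < 0 := by
    rw [hd, inner_sub_right, inner_smul_right, inner_smul_right, real_inner_self_eq_norm_sq,
      real_inner_comm]
    nlinarith
  have h2 : 0 < ⟪θ, d⟫ := by
    rw [hd, inner_sub_right, inner_smul_right, inner_smul_right, real_inner_self_eq_norm_sq]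
    nlinarith
  have hder : HasDerivAt (fun t : ℝ => g (a + t • d)) ⟪G, d⟫ 0 := by
    have hline : HasDerivAt (fun t : ℝ => a + t • d) d 0 := by
      simpa using ((hasDerivAt_id (0 : ℝ)).smul_const d).const_add a
    have hgr : HasFDerivAt g (InnerProductSpace.toDual ℝ (E n) G) (a + (0 : ℝ) • d) := by
      rw [zero_smul, add_zero]
      exact (hg a).hasGradientAt.hasFDerivAt
    exact hgr.comp_hasDerivAt (0 : ℝ) hline
  have hslope := hasDerivWithinAt_iff_tendsto_slope' (s := Ioi (0 : ℝ)) (by simp) |>.1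
    hder.hasDerivWithinAt
  refine absurd (ge_of_tendsto hslope (eventually_nhdsWithin_of_forall fun t ht => ?_)) h1.not_ge
  have ht' : 0 < t := ht
  have hout : 0 < g (a + t • d) := by
    by_contra hle
    have := ha.2 (a + t • d) (not_lt.1 hle)
    rw [inner_add_right, inner_smul_right] at this
    nlinarith
  have hin : g a ≤ 0 := ha.1
  rw [slope_def_field]
  simp only [zero_smul, add_zero, sub_zero]
  exact div_nonneg (by linarith) ht'.le

lemma exists_lipschitzOn_gradient (hg : ContDiff ℝ 2 g) (R : ℝ) :
    ∃ L : ℝ, 0 < L ∧ ∀ a b : E n, ‖a‖ ≤ R → ‖b‖ ≤ R →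
      ‖gradient g a - gradient g b‖ ≤ L * ‖a - b‖ := by
  obtain ⟨K, hK⟩ := (hg.fderiv_right (m := 1) (by norm_num)).contDiffOn.exists_lipschitzOnWith
    (s := Metric.closedBall (0 : E n) R) one_ne_zero (convex_closedBall _ _)
    (isCompact_closedBall _ _)
  refine ⟨K + 1, by positivity, fun a b ha hb => ?_⟩
  have h := hK.dist_le_mul a (by simpa using ha) b (by simpa using hb)
  rw [dist_eq_norm, dist_eq_norm] at h
  have h2 : ‖gradient g a - gradient g b‖ = ‖fderiv ℝ g a - fderiv ℝ g b‖ := by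
    rw [gradient, gradient, ← map_sub, LinearIsometryEquiv.norm_map]
  rw [h2]
  nlinarith [norm_nonneg (a - b)]

lemma exists_unit_orthogonal (hn : 2 ≤ n) (a : E n) : ∃ v : E n, ‖v‖ = 1 ∧ ⟪v, a⟫ = 0 := by
  have hbot : (Submodule.span ℝ {a})ᗮ ≠ ⊥ := by
    intro h
    rw [Submodule.orthogonal_eq_bot_iff] at h
    have h1 : Module.finrank ℝ (Submodule.span ℝ {a}) ≤ 1 := by
      simpa using finrank_span_le_card (R := ℝ) ({a} : Set (E n))
    rw [h, finrank_top, finrank_euclideanSpace_fin] at h1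
    omega
  obtain ⟨w, hw, hw0⟩ := Submodule.exists_mem_ne_zero_of_ne_bot hbot
  refine ⟨(‖w‖⁻¹ : ℝ) • w, norm_smul_inv_norm hw0, ?_⟩
  rw [inner_smul_left, real_inner_comm, Submodule.mem_orthogonal_singleton_iff_inner_right.1 hw,
    mul_zero]

/-- Perturbing an interior parameter `θ₀` in a direction `v` orthogonal to its optimal action
`a⋆(θ₀)` displaces the optimal action by an amount comparable to the perturbation. The lower bound
holds since `θ₀ᵀ a⋆(θ₀) > 0` prevents `v` from being parallel to `θ₀`, so that the normal of the
set at the optimal action turns at a positive rate; the upper bound is quadratic growth. -/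
lemma exists_displacing_direction (hn : 2 ≤ n) {Θ : Set (E n)} (hΘ : ParameterAssumption Θ)
    (hA : ActionSetAssumption g Θ) (hne : (actionSet g).Nonempty) :
    ∃ θ₀ ∈ Θ, ∃ v : E n, ‖v‖ = 1 ∧ ⟪v, aStar (actionSet g) θ₀⟫ = 0 ∧
      ∃ δ₀ c C : ℝ, 0 < δ₀ ∧ 0 < c ∧ 0 < C ∧ ∀ δ : ℝ, 0 < δ → δ ≤ δ₀ → θ₀ + δ • v ∈ Θ ∧
        c * δ ≤ ‖aStar (actionSet g) (θ₀ + δ • v) - aStar (actionSet g) θ₀‖ ∧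
        ‖aStar (actionSet g) (θ₀ + δ • v) - aStar (actionSet g) θ₀‖ ≤ C * δ := by
  obtain ⟨θmin, hθmin, hθmin'⟩ := hΘ.away_from_zero
  obtain ⟨θmax, hθmax'⟩ := hΘ.bounded.exists_norm_le
  obtain ⟨κ, hκ, hgrow⟩ := exists_quadratic_growth hA.compact hA.contDiff_two hA.strongly_convex
  obtain ⟨R, hR⟩ := hA.compact.isBounded.exists_norm_le
  obtain ⟨L, hL, hlip⟩ := exists_lipschitzOn_gradient hA.contDiff_two R
  obtain ⟨m', hm', ⟨gradMin, gradMax, lamMin, lamMax, hgm, -, -, hgrad⟩, -,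
    α, -, hα, hangle⟩ := hA.local_bounds
  obtain ⟨θ₀, hθ₀⟩ := hΘ.interior_nonempty
  have hθ₀Θ := interior_subset hθ₀
  have hmax := aStar_mem_maximizers hA.compact hne
  have hmem : ∀ θ ∈ Θ, aStar (actionSet g) θ ∈ optimalActionsNhd (actionSet g) Θ m' :=
    fun θ hθ => mem_iUnion₂.2 ⟨_, mem_iUnion₂.2 ⟨θ, hθ, hmax θ⟩, Metric.mem_closedBall_self hm'.le⟩
  set a := aStar (actionSet g) with ha
  have hG : ∀ θ ∈ Θ, gradMin ≤ ‖gradient g (a θ)‖ := fun θ hθ => (hgrad _ (hmem θ hθ)).1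
  have hnormal : ∀ θ ∈ Θ, ‖gradient g (a θ)‖ • θ = ‖θ‖ • gradient g (a θ) := fun θ hθ =>
    norm_smul_eq_norm_smul_gradient (hA.contDiff_two.differentiable (by norm_num)) (hmax θ)
      (norm_pos_iff.1 (hgm.trans_le (hG θ hθ)))
  have hθ₀n : 0 < ‖θ₀‖ := hθmin.trans_le (hθmin' _ hθ₀Θ)
  have hG₀n : 0 < ‖gradient g (a θ₀)‖ := hgm.trans_le (hG _ hθ₀Θ)
  have hpos : 0 < ⟪θ₀, a θ₀⟫ := by
    have h1 : InnerProductGeometry.angle (a θ₀) (gradient g (a θ₀)) < Real.pi / 2 :=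
      (hangle _ (hmem _ hθ₀Θ) _ (Metric.mem_closedBall_self hm'.le)).trans_lt hα
    have h2 : 0 < ⟪a θ₀, gradient g (a θ₀)⟫ := by
      have hcos := Real.cos_pos_of_mem_Ioo ⟨by
        have := InnerProductGeometry.angle_nonneg (a θ₀) (gradient g (a θ₀))
        linarith [Real.pi_pos], h1⟩
      rw [InnerProductGeometry.cos_angle] at hcos
      by_contra hle
      exact hcos.not_ge (div_nonpos_of_nonpos_of_nonneg (not_lt.1 hle) (by positivity))
    have h3 := congrArg (fun x => ⟪a θ₀, x⟫) (hnormal _ hθ₀Θ)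
    simp only [inner_smul_right] at h3
    rw [real_inner_comm]
    by_contra hle
    have := mul_pos hθ₀n h2
    nlinarith
  obtain ⟨v, hv1, hv0⟩ := exists_unit_orthogonal hn (a θ₀)
  obtain ⟨r, hr, hball⟩ := Metric.isOpen_iff.1 isOpen_interior _ hθ₀
  -- `w` is the component of `v` orthogonal to `θ₀`
  set w : E n := v - (⟪θ₀, v⟫ / ‖θ₀‖ ^ 2) • θ₀ with hw
  have hwθ : ⟪θ₀, w⟫ = 0 := by
    rw [hw, inner_sub_right, inner_smul_right, real_inner_self_eq_norm_sq]
    field_simp; ring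
  have hvw : ⟪v, w⟫ = ‖w‖ ^ 2 := by
    rw [← real_inner_self_eq_norm_sq w]
    nth_rw 2 [hw]
    rw [inner_sub_left, inner_smul_left, hwθ]; simp
  have hw0 : 0 < ‖w‖ := by
    rw [norm_pos_iff]
    intro h0
    have hvθ : v = (⟪θ₀, v⟫ / ‖θ₀‖ ^ 2) • θ₀ := sub_eq_zero.1 h0
    rw [hvθ, inner_smul_left] at hv0
    have hz : ⟪θ₀, v⟫ / ‖θ₀‖ ^ 2 = 0 := (mul_eq_zero.1 hv0).resolve_right hpos.ne'
    rw [hz, zero_smul] at hvθ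
    rw [hvθ] at hv1
    simp at hv1
  have hθmax : 0 < θmax := hθ₀n.trans_le (hθmax' _ hθ₀Θ)
  refine ⟨θ₀, hθ₀Θ, v, hv1, hv0, r / 2, gradMin * ‖w‖ / (θmax * L), 1 / (2 * κ * θmin),
    by positivity, by positivity, by positivity, fun δ hδ hδr => ?_⟩
  have hθ₁ : θ₀ + δ • v ∈ Θ := interior_subset (hball (by
    rw [Metric.mem_ball, dist_eq_norm, add_sub_cancel_left, norm_smul, hv1,
      Real.norm_of_nonneg hδ.le]
    linarith))
  set θ₁ := θ₀ + δ • v with hθ₁def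
  refine ⟨hθ₁, ?_, ?_⟩
  · have h0 : ⟪gradient g (a θ₀), w⟫ = 0 := by
      have h3 := congrArg (fun x => ⟪x, w⟫) (hnormal _ hθ₀Θ)
      simp only [inner_smul_left, hwθ, mul_zero] at h3
      exact (mul_eq_zero.1 h3.symm).resolve_left (by simpa using hθ₀n.ne')
    have h1 : ‖gradient g (a θ₁)‖ * (δ * ‖w‖ ^ 2) = ‖θ₁‖ * ⟪gradient g (a θ₁), w⟫ := by
      have h3 := congrArg (fun x => ⟪x, w⟫) (hnormal _ hθ₁)
      simp only [inner_smul_left] at h3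
      rw [hθ₁def, inner_add_left, hwθ, inner_smul_left, hvw] at h3
      simpa using h3
    have h2 : ⟪gradient g (a θ₁), w⟫ ≤ L * ‖a θ₁ - a θ₀‖ * ‖w‖ := by
      calc ⟪gradient g (a θ₁), w⟫ = ⟪gradient g (a θ₁) - gradient g (a θ₀), w⟫ := by
            rw [inner_sub_left, h0, sub_zero]
        _ ≤ ‖gradient g (a θ₁) - gradient g (a θ₀)‖ * ‖w‖ := real_inner_le_norm _ _
        _ ≤ _ := by
            gcongr
            exact hlip _ _ (hR _ (hmax θ₁).1) (hR _ (hmax θ₀).1)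
    have h3 : gradMin * (δ * ‖w‖ ^ 2) ≤ θmax * (L * ‖a θ₁ - a θ₀‖ * ‖w‖) :=
      calc gradMin * (δ * ‖w‖ ^ 2) ≤ ‖gradient g (a θ₁)‖ * (δ * ‖w‖ ^ 2) := by
            gcongr; exact hG _ hθ₁
        _ = ‖θ₁‖ * ⟪gradient g (a θ₁), w⟫ := h1
        _ ≤ ‖θ₁‖ * (L * ‖a θ₁ - a θ₀‖ * ‖w‖) := by gcongr
        _ ≤ _ := by gcongr; exact hθmax' _ hθ₁
    rw [div_mul_eq_mul_div, div_le_iff₀ (by positivity)]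
    refine le_of_mul_le_mul_right ?_ hw0
    linarith
  · have h0 := hgrow θ₀ (a θ₀) (a θ₁) (hmax θ₀) (hmax θ₁).1
    have h1 := hgrow θ₁ (a θ₁) (a θ₀) (hmax θ₁) (hmax θ₀).1
    rw [norm_sub_rev (a θ₀)] at h1
    have h2 : (⟪θ₁, a θ₁⟫ - ⟪θ₁, a θ₀⟫) + (⟪θ₀, a θ₀⟫ - ⟪θ₀, a θ₁⟫) = δ * ⟪v, a θ₁ - a θ₀⟫ := by
      rw [hθ₁def, inner_add_left, inner_add_left, inner_smul_left, inner_smul_left,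
        inner_sub_right]
      simp; ring
    have h3 : ⟪v, a θ₁ - a θ₀⟫ ≤ ‖a θ₁ - a θ₀‖ := by
      simpa [hv1] using real_inner_le_norm v (a θ₁ - a θ₀)
    set D := ‖a θ₁ - a θ₀‖ with hD
    have hD0 : 0 ≤ D := norm_nonneg _
    have h4 : κ * θmin * D ^ 2 ≤ κ * ‖θ₀‖ * D ^ 2 := by gcongr; exact hθmin' _ hθ₀Θ
    have h5 : κ * θmin * D ^ 2 ≤ κ * ‖θ₁‖ * D ^ 2 := by gcongr; exact hθmin' _ hθ₁
    have h6 : δ * ⟪v, a θ₁ - a θ₀⟫ ≤ δ * D := by gcongr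
    rw [div_mul_eq_mul_div, one_mul, le_div_iff₀ (by positivity)]
    by_contra hlt
    rcases hD0.eq_or_lt with h | h
    · rw [← h] at hlt; linarith
    · nlinarith

end Geometry

/-! ### Regret and deviations from the optimal action -/

section Regret

variable {n : ℕ} {A : Set (E n)} {p : ℝ → ℝ}

lemma ae_mem_historyLaw (hp : NoiseAssumption p) (hA : IsClosed A) (θ : E n) (π : Policy A)
    (T : ℕ) : ∀ᵐ h ∂(historyLaw θ p π T), ∀ t, (h t).1 ∈ A := by
  have hmeas : ∀ T, MeasurableSet {h : History n T | ∀ t, (h t).1 ∈ A} := fun T => by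
    rw [ofPred_forall]
    exact MeasurableSet.iInter fun t =>
      hA.measurableSet.preimage (measurable_pi_apply t).fst
  induction T with
  | zero => exact Filter.Eventually.of_forall fun h t => t.elim0
  | succ T ih =>
    have hs := measurable_snoc (n := n) T
    have := isMarkovKernel_rewardKernel hp θ
    have := isMarkovKernel_roundKernel hp θ π T
    have := isProbabilityMeasure_historyLaw hp θ π T
    rw [historyLaw, ae_map_iff hs.aemeasurable (hmeas _),
      Measure.ae_compProd_iff
        (p := fun q => ∀ t, ((Fin.snoc q.1 q.2 : History n (T + 1)) t).1 ∈ A)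
        (hs (hmeas (T + 1)))]
    filter_upwards [ih] with h hh
    rw [roundKernel, Kernel.ae_compProd_iff
      (p := fun q => ∀ t, ((Fin.snoc h q : History n (T + 1)) t).1 ∈ A)
      ((hs.comp measurable_prodMk_left) (hmeas (T + 1)))]
    filter_upwards [π.mem T h] with a ha
    refine Filter.Eventually.of_forall fun y t => ?_
    induction t using Fin.lastCases with
    | last => simpa using ha
    | cast t => simpa using hh t

/-- Under quadratic growth of the reward around its maximizer, the expected regret controls the
expected squared deviation of the actions from the optimal one; it is moreover bounded. -/
lemma lintegral_deviation_le (hp : NoiseAssumption p) (hA : IsClosed A) (θ : E n) (π : Policy A)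
    (T : ℕ) {κ R : ℝ} (hκ : 0 < κ)
    (hgrow : ∀ b ∈ A, κ * ‖b - aStar A θ‖ ^ 2 ≤ ⟪θ, aStar A θ⟫ - ⟪θ, b⟫)
    (hR : ∀ b ∈ A, ⟪θ, aStar A θ⟫ - ⟪θ, b⟫ ≤ R) :
    (∫⁻ h, ∑ t, ENNReal.ofReal (‖(h t).1 - aStar A θ‖ ^ 2) ∂(historyLaw θ p π T) ≤
      ENNReal.ofReal (expectedRegret θ p π T / κ)) ∧
    0 ≤ expectedRegret θ p π T ∧ expectedRegret θ p π T ≤ T * R := by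
  have := isProbabilityMeasure_historyLaw hp θ π T
  have hmem := ae_mem_historyLaw hp hA θ π T
  have hlow : ∀ᵐ h ∂(historyLaw θ p π T),
      κ * ∑ t, ‖(h t).1 - aStar A θ‖ ^ 2 ≤ regret A θ h := by
    filter_upwards [hmem] with h hh
    rw [Finset.mul_sum]
    exact Finset.sum_le_sum fun t _ => hgrow _ (hh t)
  have hnn : ∀ᵐ h ∂(historyLaw θ p π T), 0 ≤ regret A θ h := by
    filter_upwards [hlow] with h hh
    exact (by positivity : 0 ≤ κ * ∑ t, ‖(h t).1 - aStar A θ‖ ^ 2).trans hh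
  have hup : ∀ᵐ h ∂(historyLaw θ p π T), regret A θ h ≤ T * R := by
    filter_upwards [hmem] with h hh
    refine (Finset.sum_le_sum fun t _ => hR _ (hh t)).trans_eq ?_
    simp
  have hmeas : Measurable fun h : History n T => regret A θ h := by
    unfold regret; fun_prop
  have hint : Integrable (fun h => regret A θ h) (historyLaw θ p π T) := by
    refine Integrable.of_bound hmeas.aestronglyMeasurable (T * R) ?_
    filter_upwards [hnn, hup] with h h1 h2
    rwa [Real.norm_of_nonneg h1]
  refine ⟨?_, integral_nonneg_of_ae hnn, ?_⟩
  · rw [div_eq_inv_mul, ENNReal.ofReal_mul (by positivity), expectedRegret,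
      ofReal_integral_eq_lintegral_ofReal hint hnn,
      ← lintegral_const_mul _ hmeas.ennreal_ofReal]
    refine lintegral_mono_ae ?_
    filter_upwards [hlow] with h hh
    rw [← ENNReal.ofReal_sum_of_nonneg fun _ _ => by positivity,
      ← ENNReal.ofReal_mul (by positivity)]
    refine ENNReal.ofReal_le_ofReal ?_
    rwa [inv_mul_eq_div, le_div_iff₀' hκ]
  · calc expectedRegret θ p π T ≤ ∫ _, (T * R : ℝ) ∂(historyLaw θ p π T) :=
        integral_mono_ae hint (integrable_const _) hup
      _ = T * R := by simp

/-- If `S` bounds the expected squared deviations from `a₀` under `θ₀` and from `a₁` under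
`θ₀ + δ v`, where `v` is orthogonal to `a₀`, then the information about `δ` gathered in `T` rounds
is at most of order `δ² S + T δ⁴`. When this is small, the two parameters cannot be told apart and
`S` is of order at least `T δ²`. -/
lemma deviation_lower_bound (hp : NoiseAssumption p) (π : Policy A) (T : ℕ) {θ₀ v a₀ a₁ : E n}
    (hv : ‖v‖ = 1) (hva : ⟪v, a₀⟫ = 0) {δ c C S : ℝ} (hδ : 0 < δ) (hc : 0 < c) (hS : 0 ≤ S)
    (hlow : c * δ ≤ ‖a₁ - a₀‖) (hup : ‖a₁ - a₀‖ ≤ C * δ)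
    (h₀ : ∫⁻ h, ∑ t, ENNReal.ofReal (‖(h t).1 - a₀‖ ^ 2) ∂(historyLaw θ₀ p π T) ≤
      ENNReal.ofReal S)
    (h₁ : ∫⁻ h, ∑ t, ENNReal.ofReal (‖(h t).1 - a₁‖ ^ 2) ∂(historyLaw (θ₀ + δ • v) p π T) ≤
      ENNReal.ofReal S)
    (hsmall : fisherInfo p * δ ^ 2 / 16 * (3 * S + 2 * T * (C * δ) ^ 2) ≤ 1 / 4) :
    T * (c * δ) ^ 2 / 16 ≤ S := by
  have hI := hp.fisher_pos
  have hprob := isProbabilityMeasure_historyLaw hp (θ₀ + δ • v) π T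
  set J := fisherInfo p * δ ^ 2 / 16 with hJ
  have hJ0 : 0 ≤ J := by positivity
  have hinner : ∀ a, ⟪θ₀ + δ • v - θ₀, a⟫ ^ 2 ≤ δ ^ 2 * ‖a - a₀‖ ^ 2 := fun a => by
    have h1 : ⟪θ₀ + δ • v - θ₀, a⟫ = δ * ⟪v, a - a₀⟫ := by
      rw [add_sub_cancel_left, inner_smul_left, inner_sub_right, hva, sub_zero]; simp
    have h2 : |⟪v, a - a₀⟫| ≤ ‖a - a₀‖ := by simpa [hv] using abs_real_inner_le_norm v (a - a₀)
    rw [h1, mul_pow]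
    exact mul_le_mul_of_nonneg_left (sq_le_sq.2 (h2.trans (le_abs_self _))) (sq_nonneg δ)
  have hsq : ∀ a, ‖a - a₀‖ ^ 2 ≤ 2 * ‖a - a₁‖ ^ 2 + 2 * (C * δ) ^ 2 := fun a => by
    have h1 : ‖a - a₀‖ ≤ ‖a - a₁‖ + ‖a₁ - a₀‖ := norm_sub_le_norm_sub_add_norm_sub _ _ _
    have h2 : ‖a - a₀‖ ≤ ‖a - a₁‖ + C * δ := by linarith
    nlinarith [norm_nonneg (a - a₀), sq_nonneg (‖a - a₁‖ - C * δ)]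
  have hsep : ∀ a, (c * δ) ^ 2 / 2 ≤ ‖a - a₀‖ ^ 2 + ‖a - a₁‖ ^ 2 := fun a => by
    have h1 : ‖a₁ - a₀‖ ≤ ‖a - a₁‖ + ‖a - a₀‖ := by
      rw [norm_sub_rev a a₁]; exact norm_sub_le_norm_sub_add_norm_sub _ _ _
    have h2 : (0 : ℝ) < c * δ := by positivity
    nlinarith [sq_nonneg (‖a - a₁‖ - ‖a - a₀‖)]
  set k : E n → ENNReal :=
    fun a => ENNReal.ofReal (fisherInfo p / 16 * ⟪θ₀ + δ • v - θ₀, a⟫ ^ 2) with hk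
  have hk₀ : ∀ a, k a ≤ ENNReal.ofReal J * ENNReal.ofReal (‖a - a₀‖ ^ 2) := fun a => by
    rw [← ENNReal.ofReal_mul hJ0]
    refine ENNReal.ofReal_le_ofReal ?_
    rw [hJ]
    nlinarith [mul_le_mul_of_nonneg_left (hinner a) hI.le]
  have hk₁ : ∀ a, k a ≤ ENNReal.ofReal (2 * J) * ENNReal.ofReal (‖a - a₁‖ ^ 2) +
      ENNReal.ofReal (2 * J * (C * δ) ^ 2) := fun a => by
    refine (hk₀ a).trans ?_
    rw [← ENNReal.ofReal_mul hJ0, ← ENNReal.ofReal_mul (by positivity),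
      ← ENNReal.ofReal_add (by positivity) (by positivity)]
    refine ENNReal.ofReal_le_ofReal ?_
    nlinarith [mul_le_mul_of_nonneg_left (hsq a) hJ0]
  have hdm : ∀ a : E n, Measurable fun h : History n T =>
      ∑ t, ENNReal.ofReal (‖(h t).1 - a‖ ^ 2) := fun a => by fun_prop
  have hinfo₀ : ∫⁻ h, ∑ t, k (h t).1 ∂(historyLaw θ₀ p π T) ≤ ENNReal.ofReal (J * S) := by
    rw [ENNReal.ofReal_mul hJ0]
    refine le_trans ?_ (mul_le_mul_right h₀ _)
    rw [← lintegral_const_mul _ (hdm a₀)]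
    refine lintegral_mono fun h => ?_
    rw [Finset.mul_sum]
    exact Finset.sum_le_sum fun t _ => hk₀ _
  have hinfo₁ : ∫⁻ h, ∑ t, k (h t).1 ∂(historyLaw (θ₀ + δ • v) p π T) ≤
      ENNReal.ofReal (2 * J * S + T * (2 * J * (C * δ) ^ 2)) := by
    rw [ENNReal.ofReal_add (by positivity) (by positivity), ENNReal.ofReal_mul (by positivity)]
    refine le_trans ?_ (add_le_add_left (mul_le_mul_right h₁ _) _)
    rw [← lintegral_const_mul _ (hdm a₁)]
    calc _ ≤ ∫⁻ h, (ENNReal.ofReal (2 * J) * ∑ t, ENNReal.ofReal (‖(h t).1 - a₁‖ ^ 2) +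
          ENNReal.ofReal (T * (2 * J * (C * δ) ^ 2))) ∂(historyLaw (θ₀ + δ • v) p π T) := by
          refine lintegral_mono fun h => (Finset.sum_le_sum fun t _ => hk₁ _).trans_eq ?_
          rw [Finset.sum_add_distrib, Finset.mul_sum, Finset.sum_const, Finset.card_univ,
            Fintype.card_fin, nsmul_eq_mul, ENNReal.ofReal_mul T.cast_nonneg,
            ENNReal.ofReal_natCast]
      _ = _ := by
          rw [lintegral_add_right _ measurable_const, lintegral_const, measure_univ, mul_one]
  have hinfo : (∫⁻ h, ∑ t, k (h t).1 ∂(historyLaw θ₀ p π T)) +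
      (∫⁻ h, ∑ t, k (h t).1 ∂(historyLaw (θ₀ + δ • v) p π T)) ≤ ENNReal.ofReal (1 / 4) := by
    refine (add_le_add hinfo₀ hinfo₁).trans ?_
    rw [← ENNReal.ofReal_add (by positivity) (by positivity)]
    exact ENNReal.ofReal_le_ofReal (by linarith)
  have hboth : ∀ h : History n T, ENNReal.ofReal (T * ((c * δ) ^ 2 / 2)) ≤
      ∑ t, ENNReal.ofReal (‖(h t).1 - a₀‖ ^ 2) + ∑ t, ENNReal.ofReal (‖(h t).1 - a₁‖ ^ 2) := by
    intro h
    rw [← Finset.sum_add_distrib]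
    calc ENNReal.ofReal (T * ((c * δ) ^ 2 / 2))
        = ∑ _t : Fin T, ENNReal.ofReal ((c * δ) ^ 2 / 2) := by
          rw [Finset.sum_const, Finset.card_univ, Fintype.card_fin, nsmul_eq_mul,
            ENNReal.ofReal_mul T.cast_nonneg, ENNReal.ofReal_natCast]
      _ ≤ _ := Finset.sum_le_sum fun t _ => by
          rw [← ENNReal.ofReal_add (sq_nonneg _) (sq_nonneg _)]
          exact ENNReal.ofReal_le_ofReal (hsep _)
  have hmain := le_lintegral_add_lintegral hp θ₀ (θ₀ + δ • v) π T hk hinfo (hdm a₀) (hdm a₁) hboth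
  replace hmain := hmain.trans (add_le_add h₀ h₁)
  rw [← ENNReal.ofReal_mul (by positivity), ← ENNReal.ofReal_add hS hS,
    ENNReal.ofReal_le_ofReal_iff (by positivity)] at hmain
  linarith

end Regret

lemma isEmpty_policy {n : ℕ} {A : Set (E n)} (hA : ¬ A.Nonempty) : IsEmpty (Policy A) := by
  refine ⟨fun π => ?_⟩
  obtain ⟨a, ha⟩ := (π.mem 0 fun i => i.elim0).exists
  exact hA ⟨a, ha⟩

end LinearBandit
end

/-! ### The lower bound -/

theorem mainTheorem4 (n : ℕ) (hn : 2 ≤ n)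
    (g : LinearBandit.E n → ℝ) (Θ : Set (LinearBandit.E n))
    (hΘ : LinearBandit.ParameterAssumption Θ)
    (hA : LinearBandit.ActionSetAssumption g Θ)
    (hreg : LinearBandit.ActionRegularity (LinearBandit.actionSet g) Θ) :
    ∃ c : ℝ, 0 < c ∧
      ∀ p : ℝ → ℝ, LinearBandit.NoiseAssumption p →
        ∃ T₀ : ℕ, ∀ π : LinearBandit.Policy (LinearBandit.actionSet g), ∀ T : ℕ, T₀ ≤ T →
          c * Real.sqrt ((T : ℝ) / LinearBandit.fisherInfo p) ≤
            ⨆ θ : Θ, LinearBandit.expectedRegret (θ : LinearBandit.E n) p π T := by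
  open LinearBandit in
  by_cases hne : (actionSet g).Nonempty
  swap
  -- without actions there is no policy
  · have := isEmpty_policy hne
    exact ⟨1, one_pos, fun p _ => ⟨0, fun π => isEmptyElim π⟩⟩
  obtain ⟨θmin, hθmin, hθmin'⟩ := hΘ.away_from_zero
  obtain ⟨θmax, hθmax'⟩ := hΘ.bounded.exists_norm_le
  obtain ⟨κ₀, hκ₀, hgrow⟩ := exists_quadratic_growth hA.compact hA.contDiff_two
    hA.strongly_convex
  obtain ⟨R, hR⟩ := hA.compact.isBounded.exists_norm_le
  obtain ⟨θ₀, hθ₀, v, hv, hva, δ₀, c, C, hδ₀, hc, hC, hδ⟩ :=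
    exists_displacing_direction hn hΘ hA hne
  have hmax := aStar_mem_maximizers hA.compact hne
  set κ := κ₀ * θmin with hκdef
  have hκ : 0 < κ := by positivity
  have hgrow' : ∀ θ ∈ Θ, ∀ b ∈ actionSet g, κ * ‖b - aStar (actionSet g) θ‖ ^ 2 ≤
      inner ℝ θ (aStar (actionSet g) θ) - inner ℝ θ b := fun θ hθ b hb => by
    refine le_trans ?_ (hgrow θ _ b (hmax θ) hb)
    rw [hκdef]
    gcongr
    exact hθmin' θ hθ
  have hbound : ∀ θ ∈ Θ, ∀ b ∈ actionSet g,
      inner ℝ θ (aStar (actionSet g) θ) - inner ℝ θ b ≤ θmax * (R + R) := fun θ hθ b hb => by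
    rw [← inner_sub_right]
    have h1 : ‖aStar (actionSet g) θ - b‖ ≤ R + R :=
      (norm_sub_le _ _).trans (add_le_add (hR _ (hmax θ).1) (hR _ hb))
    have h2 := hθmax' θ hθ
    exact (real_inner_le_norm _ _).trans
      (mul_le_mul h2 h1 (norm_nonneg _) ((norm_nonneg _).trans h2))
  -- `δ² = ε / √(T I)` balances the two cases below; `ε C = 1` makes the term `T δ⁴` of the
  -- information small.
  set ε := 1 / C with hε
  have hε0 : 0 < ε := by positivity
  have hεC : ε * C = 1 := by rw [hε]; field_simp
  refine ⟨κ * min (c ^ 2 * ε / 16) (2 / (3 * ε)), by positivity, fun p hp => ?_⟩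
  have hI := hp.fisher_pos
  set I := fisherInfo p with hIdef
  obtain ⟨T₀, hT₀⟩ := exists_nat_ge ((ε / δ₀ ^ 2) ^ 2 / I)
  refine ⟨T₀ + 1, fun π T hT => ?_⟩
  have hTT₀ : (T₀ : ℝ) + 1 ≤ T := by exact_mod_cast hT
  have hT0 : (0 : ℝ) < T := by linarith [T₀.cast_nonneg (α := ℝ)]
  set N := √(T * I) with hN
  have hN0 : 0 < N := Real.sqrt_pos.2 (by positivity)
  have hN2 : N ^ 2 = T * I := Real.sq_sqrt (by positivity)
  have hNT : √((T : ℝ) / I) = N / I := by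
    rw [show (T : ℝ) / I = (T * I) / I ^ 2 by field_simp, Real.sqrt_div (by positivity),
      Real.sqrt_sq hI.le]
  have hεN : ε / δ₀ ^ 2 ≤ N := by
    refine Real.le_sqrt_of_sq_le ?_
    rw [← div_le_iff₀ hI]
    linarith
  set δ := √(ε / N) with hδdef
  have hδ0 : 0 < δ := Real.sqrt_pos.2 (by positivity)
  have hδ2 : δ ^ 2 = ε / N := Real.sq_sqrt (by positivity)
  have hδδ₀ : δ ≤ δ₀ := by
    refine Real.sqrt_le_iff.2 ⟨hδ₀.le, ?_⟩
    rw [div_le_iff₀ (by positivity)] at hεN ⊢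
    linarith
  obtain ⟨hθ₁, hlow, hup⟩ := hδ δ hδ0 hδδ₀
  have hdev : ∀ θ ∈ Θ, _ := fun θ hθ => lintegral_deviation_le hp hA.compact.isClosed θ π T hκ
    (hgrow' θ hθ) (hbound θ hθ)
  have hbdd : BddAbove (range fun θ : Θ => expectedRegret (θ : E n) p π T) :=
    ⟨T * (θmax * (R + R)), by rintro _ ⟨θ, rfl⟩; exact (hdev θ θ.2).2.2⟩
  set B := ⨆ θ : Θ, expectedRegret (θ : E n) p π T with hB
  have hle : ∀ θ ∈ Θ, expectedRegret θ p π T ≤ B := fun θ hθ => le_ciSup hbdd ⟨θ, hθ⟩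
  have hB0 : 0 ≤ B := (hdev _ hθ₀).2.1.trans (hle _ hθ₀)
  have hS : ∀ θ ∈ Θ, ∫⁻ h, ∑ t, ENNReal.ofReal (‖(h t).1 - aStar (actionSet g) θ‖ ^ 2)
      ∂(historyLaw θ p π T) ≤ ENNReal.ofReal (B / κ) := fun θ hθ =>
    (hdev θ hθ).1.trans (ENNReal.ofReal_le_ofReal (by gcongr; exact hle θ hθ))
  have hgoal : min (c ^ 2 * ε / 16) (2 / (3 * ε)) * (N / I) ≤ B / κ := by
    have hNI : 0 < N / I := by positivity
    have hTN : (T : ℝ) = N ^ 2 / I := by rw [hN2]; field_simp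
    by_cases hsmall : I * δ ^ 2 / 16 * (3 * (B / κ) + 2 * T * (C * δ) ^ 2) ≤ 1 / 4
    · have h1 := deviation_lower_bound hp π T hv hva hδ0 hc (by positivity) hlow hup
        (hS _ hθ₀) (hS _ hθ₁) hsmall
      refine le_trans ?_ h1
      calc _ ≤ c ^ 2 * ε / 16 * (N / I) := by gcongr; exact min_le_left _ _
        _ = _ := by rw [mul_pow, hδ2, hTN]; field_simp
    · have h2 : I * δ ^ 2 / 16 * (3 * (B / κ) + 2 * T * (C * δ) ^ 2) =
          3 * ε / 16 * ((B / κ) / (N / I)) + (ε * C) ^ 2 / 8 := by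
        rw [mul_pow, hδ2, hTN]; field_simp; ring
      rw [h2, hεC, not_le] at hsmall
      have h3 : 2 / (3 * ε) ≤ (B / κ) / (N / I) := by
        rw [div_le_iff₀ (by positivity)]; linarith
      rw [le_div_iff₀ hNI] at h3
      refine le_trans ?_ h3
      gcongr
      exact min_le_right _ _
  rw [hNT, mul_assoc]
  rwa [le_div_iff₀' hκ] at hgoal
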